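/- Let $K$ be an algebraically closed field (of any characteristic), let $n\ge 0$, let $F_n=K\langle z_1,\dots,z_n\rangle$ be the free associative unital $K$-algebra on $n$ generators, and let $\mathbb{T}_n=(K^\times)^n$ be the $n$-dimensional algebraic torus. An action of $\mathbb{T}_n$ on $F_n$ is a group homomorphism $\sigma:\mathbb{T}_n\to\operatorname{Aut}_K F_n$. It is regular if for every $f\in F_n$ there are elements $f_m\in F_n$ ($m\in\mathbb{Z}^n$), all but finitely many of them zero, such that $\sigma(t)(f)=\sum_{m\in\mathbb{Z}^n} t_1^{m_1}\cdots t_n^{m_n}f_m$ for all $t=(t_1,\dots,t_n)\in\mathbb{T}_n$. It is effective if for every $t\neq 1$ in $\mathbb{T}_n$ there is $f\in F_n$ with $\sigma(t)(f)\ne f$. Every effective regular action $\sigma$ of $\mathbb{T}_n$ on $F_n$ is linearizable: there are an automorphism $\beta\in\operatorname{Aut}_K F_n$ and an action $\tau:\mathbb{T}_n\to\operatorname{Aut}_K F_n$ of the diagonal linear form $$\tau(t)(z_i)=t_1^{m_{i1}}\cdots t_n^{m_{in}}\,z_i\qquad(t\in\mathbb{T}_n,\ 1\le i\le n),$$ with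 integers $m_{ij}$ that do not depend on $t$, such that $\tau(t)=\beta^{-1}\circ\sigma(t)\circ\beta$ for all $t\in\mathbb{T}_n$. -/

import Mathlib

namespace FreeTorus

/-- The `n`-dimensional algebraic torus `(K^×)^n`, with coordinatewise multiplication. -/
abbrev Torus (K : Type*) [Field K] (n : ℕ) : Type _ := Fin n → Kˣ

/-- The Laurent monomial `t_1 ^ m_1 ⋯ t_n ^ m_n`. -/
def laurentMonomial {K : Type*} [Field K] {n : ℕ} (m : Fin n → ℤ) (t : Torus K n) : K :=
  ((∏ j, t j ^ m j : Kˣ) : K)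

/-- An action of the torus by automorphisms of a `K`-algebra `A` is regular if for each `a : A` the
element `σ t a` is a Laurent polynomial in the coordinates of `t`, with coefficients in `A`. -/
def IsRegularAction {K : Type*} [Field K] {n : ℕ} {A : Type*} [Ring A] [Algebra K A]
    (σ : Torus K n →* (A ≃ₐ[K] A)) : Prop :=
  ∀ a : A, ∃ c : (Fin n → ℤ) →₀ A, ∀ t : Torus K n,
    σ t a = c.sum fun m x => laurentMonomial m t • x

/-- An action is effective if every `t ≠ 1` moves some element. -/
def IsEffectiveAction {K : Type*} [Field K] {n : ℕ} {A : Type*} [Ring A] [Algebra K A]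
    (σ : Torus K n →* (A ≃ₐ[K] A)) : Prop :=
  ∀ t : Torus K n, t ≠ 1 → ∃ a : A, σ t a ≠ a

/-- An action on the free algebra `K⟨z_1, …, z_n⟩` is diagonal linear if there is an integer matrix
`m` with `σ t z_i = (∏ j, t_j ^ m_{ij}) z_i` for all `t` and `i`. -/
def IsDiagonalLinearAction {K : Type*} [Field K] {n : ℕ}
    (σ : Torus K n →* (FreeAlgebra K (Fin n) ≃ₐ[K] FreeAlgebra K (Fin n))) : Prop :=
  ∃ m : Fin n → Fin n → ℤ, ∀ (t : Torus K n) (i : Fin n),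
    σ t (FreeAlgebra.ι K i) = laurentMonomial (m i) t • FreeAlgebra.ι K i

/-- An action on the free algebra is linearizable if it is conjugate, by one automorphism `β` of the
free algebra, to a diagonal linear action. Multiplication of automorphisms is composition. -/
def IsLinearizable {K : Type*} [Field K] {n : ℕ}
    (σ : Torus K n →* (FreeAlgebra K (Fin n) ≃ₐ[K] FreeAlgebra K (Fin n))) : Prop :=
  ∃ (β : FreeAlgebra K (Fin n) ≃ₐ[K] FreeAlgebra K (Fin n))
    (τ : Torus K n →* (FreeAlgebra K (Fin n) ≃ₐ[K] FreeAlgebra K (Fin n))),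
    IsDiagonalLinearAction τ ∧ ∀ t : Torus K n, τ t = β⁻¹ * σ t * β

end FreeTorus

/-!
A regular action grades an algebra by its weight spaces. For the action induced on the commutative
polynomials, effectiveness yields `n` nonzero weight vectors with linearly independent weights.
These are algebraically independent over the weight-zero part, which is therefore algebraic over
`K` by transcendence degree, hence equal to `K`. Since the only units are constants, vectors of
opposite nonzero weights multiply to zero, so projection onto weight zero is an invariant
augmentation: a fixed point, which is moved to the origin by a translation.

At the origin the linear parts of the weight vectors span, so after a linear change of coordinates
there are weight vectors `uᵢ = zᵢ + (terms of degree at least 2)`. The weight of any weight vector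
can be read off its lowest words; by effectiveness the weights of the `uᵢ` are then independent, and
words of equal weight have equal length. Hence `zᵢ ↦ uᵢ` is surjective: on each weight space, a
combination of the `u`-words with the same coefficients at words of that weight has no lowest word
left in the difference. It is injective because it preserves lowest terms.
-/

namespace FreeTorus

open Module

section Characters

variable {K : Type*} [Field K] {n : ℕ}

theorem laurentMonomial_mul (m : Fin n → ℤ) (s t : Torus K n) :
    laurentMonomial m (s * t) = laurentMonomial m s * laurentMonomial m t := by
  simp [laurentMonomial, mul_zpow, Finset.prod_mul_distrib]

theorem laurentMonomial_one (m : Fin n → ℤ) : laurentMonomial m (1 : Torus K n) = 1 := by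
  simp [laurentMonomial]

theorem laurentMonomial_add (m m' : Fin n → ℤ) (t : Torus K n) :
    laurentMonomial (m + m') t = laurentMonomial m t * laurentMonomial m' t := by
  simp [laurentMonomial, zpow_add, Finset.prod_mul_distrib]

theorem laurentMonomial_zero (t : Torus K n) : laurentMonomial 0 t = 1 := by
  simp [laurentMonomial]

/-- The one-parameter subgroup of the torus with exponent vector `v`. -/
def oneParameterSubgroup (K : Type*) [Field K] {n : ℕ} (v : Fin n → ℤ) : Kˣ →* Torus K n where
  toFun a j := a ^ v j
  map_one' := by ext; simp
  map_mul' a b := by ext; simp [mul_zpow]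

theorem oneParameterSubgroup_apply (v : Fin n → ℤ) (a : Kˣ) (j : Fin n) :
    oneParameterSubgroup K v a j = a ^ v j := rfl

theorem laurentMonomial_oneParameterSubgroup (m v : Fin n → ℤ) (a : Kˣ) :
    laurentMonomial m (oneParameterSubgroup K v a) = (a ^ (m ⬝ᵥ v) : Kˣ) := by
  have h : a ^ (m ⬝ᵥ v) = ∏ j, a ^ (m j * v j) :=
    map_sum (zmultiplesHom (Additive Kˣ) (Additive.ofMul a)) _ _
  simp only [laurentMonomial, oneParameterSubgroup_apply, h, ← zpow_mul, mul_comm]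

theorem exists_zpow_ne_one [Infinite K] {d : ℤ} (hd : d ≠ 0) : ∃ a : Kˣ, a ^ d ≠ 1 := by
  classical
  obtain ⟨x, hx⟩ :=
    Infinite.exists_notMem_finset (insert 0 (Polynomial.nthRootsFinset d.natAbs (1 : K)))
  rw [Finset.mem_insert, not_or, Polynomial.mem_nthRootsFinset (Int.natAbs_pos.mpr hd)] at hx
  refine ⟨Units.mk0 x hx.1, fun h => hx.2 ?_⟩
  simpa using congrArg Units.val (pow_natAbs_eq_one.mpr h)

theorem exists_oneParameterSubgroup_ne_one [Infinite K] {v : Fin n → ℤ} (hv : v ≠ 0) :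
    ∃ a : Kˣ, oneParameterSubgroup K v a ≠ 1 := by
  obtain ⟨j, hj⟩ := Function.ne_iff.mp hv
  obtain ⟨a, ha⟩ := exists_zpow_ne_one (K := K) hj
  exact ⟨a, fun h => ha (congrFun h j)⟩

/-- A Laurent monomial as a character of the torus. -/
def laurentCharacter (K : Type*) [Field K] {n : ℕ} (m : Fin n → ℤ) : Torus K n →* K where
  toFun := laurentMonomial m
  map_one' := laurentMonomial_one m
  map_mul' := laurentMonomial_mul m

theorem laurentCharacter_injective [Infinite K] :
    Function.Injective (laurentCharacter K (n := n)) := by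
  intro m m' h
  ext j
  by_contra hne
  obtain ⟨a, ha⟩ := exists_zpow_ne_one (K := K) (sub_ne_zero.mpr hne)
  have hj : laurentMonomial m _ = laurentMonomial m' _ :=
    DFunLike.congr_fun h (oneParameterSubgroup K (Pi.single j 1) a)
  simp only [laurentMonomial_oneParameterSubgroup, dotProduct_single, mul_one, Units.val_inj] at hj
  exact ha (by rw [zpow_sub, hj, mul_inv_cancel])

theorem eq_zero_of_sum_laurentMonomial_smul_eq_zero [Infinite K] {V : Type*} [AddCommGroup V]
    [Module K V] (s : Finset (Fin n → ℤ)) (c : (Fin n → ℤ) → V)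
    (h : ∀ t : Torus K n, ∑ m ∈ s, laurentMonomial m t • c m = 0) : ∀ m ∈ s, c m = 0 := by
  intro m hm
  rw [← forall_dual_apply_eq_zero_iff K]
  intro φ
  have hli := (linearIndependent_monoidHom (Torus K n) K).comp _
    (laurentCharacter_injective (K := K) (n := n))
  refine linearIndependent_iff'.mp hli s (fun m => φ (c m)) ?_ m hm
  ext t
  simpa [laurentCharacter, mul_comm] using congrArg φ (h t)

end Characters

section WeightSpaces

variable {K : Type*} [Field K] {n : ℕ} {A : Type*} [Ring A] [Algebra K A]
  {σ : Torus K n →* (A ≃ₐ[K] A)}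

/-- The elements on which the torus acts through the character `t ^ m`. -/
def weightSpace (σ : Torus K n →* (A ≃ₐ[K] A)) (m : Fin n → ℤ) : Submodule K A where
  carrier := {a | ∀ t, σ t a = laurentMonomial m t • a}
  add_mem' ha hb t := by rw [map_add, ha t, hb t, smul_add]
  zero_mem' t := by simp
  smul_mem' c a ha t := by rw [map_smul, ha t, smul_comm]

instance weightSpace_gradedMonoid (σ : Torus K n →* (A ≃ₐ[K] A)) :
    SetLike.GradedMonoid (weightSpace σ) where
  one_mem t := by rw [map_one, laurentMonomial_zero, one_smul]
  mul_mem m m' a b ha hb t := by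
    rw [map_mul, ha t, hb t, smul_mul_smul_comm, laurentMonomial_add]

theorem iSupIndep_weightSpace [Infinite K] (σ : Torus K n →* (A ≃ₐ[K] A)) :
    iSupIndep (weightSpace σ) := by
  rw [iSupIndep_iff_finsetSum_eq_zero_imp_eq_zero]
  intro s a ha h
  refine eq_zero_of_sum_laurentMonomial_smul_eq_zero (K := K) s a fun t => ?_
  calc ∑ m ∈ s, laurentMonomial m t • a m = σ t (∑ m ∈ s, a m) := by
        rw [map_sum]; exact Finset.sum_congr rfl fun m hm => (ha m hm t).symm
    _ = 0 := by rw [h, map_zero]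

theorem IsRegularAction.iSup_weightSpace_eq_top [Infinite K] (hreg : IsRegularAction σ) :
    ⨆ m, weightSpace σ m = ⊤ := by
  rw [eq_top_iff]
  intro a _
  obtain ⟨c, hc⟩ := hreg a
  have hmem : ∀ m ∈ c.support, c m ∈ weightSpace σ m := by
    intro m hm s
    rw [← sub_eq_zero]
    refine eq_zero_of_sum_laurentMonomial_smul_eq_zero (K := K) c.support
      (fun m => σ s (c m) - laurentMonomial m s • c m) (fun t => ?_) m hm
    have hst : σ (s * t) a = σ s (σ t a) := by rw [map_mul, AlgEquiv.mul_apply]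
    simp only [hc, Finsupp.sum, map_sum, map_smul] at hst
    simp only [smul_sub, Finset.sum_sub_distrib, ← hst, smul_smul, laurentMonomial_mul, mul_comm,
      sub_self]
  have ha : a = ∑ m ∈ c.support, c m := by
    simpa only [map_one, AlgEquiv.one_apply, Finsupp.sum, laurentMonomial_one, one_smul] using hc 1
  rw [ha]
  exact Submodule.sum_mem _ fun m hm => Submodule.mem_iSup_of_mem m (hmem m hm)

/-- A regular action of the torus grades the algebra by its weight spaces. -/
@[reducible] noncomputable def IsRegularAction.gradedAlgebra [Infinite K]
    (hreg : IsRegularAction σ) : GradedAlgebra (weightSpace σ) :=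
  { weightSpace_gradedMonoid σ with
    toDecomposition := ((DirectSum.isInternal_submodule_iff_iSupIndep_and_iSup_eq_top _).mpr
      ⟨iSupIndep_weightSpace σ, hreg.iSup_weightSpace_eq_top⟩).chooseDecomposition }

theorem IsEffectiveAction.eq_zero_of_dotProduct_eq_zero [Infinite K] (heff : IsEffectiveAction σ)
    (hreg : IsRegularAction σ) {v : Fin n → ℤ}
    (hv : ∀ m, weightSpace σ m ≠ ⊥ → m ⬝ᵥ v = 0) : v = 0 := by
  by_contra hv0
  obtain ⟨a, ha⟩ := exists_oneParameterSubgroup_ne_one (K := K) hv0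
  have hfix : ∀ x, σ (oneParameterSubgroup K v a) x = x := by
    intro x
    have hx : x ∈ ⨆ m, weightSpace σ m := hreg.iSup_weightSpace_eq_top ▸ Submodule.mem_top
    induction hx using Submodule.iSup_induction' with
    | mem m x hx =>
      by_cases hm : weightSpace σ m = ⊥
      · rw [hm, Submodule.mem_bot] at hx
        rw [hx, map_zero]
      · rw [hx, laurentMonomial_oneParameterSubgroup, hv m hm, zpow_zero, Units.val_one, one_smul]
    | zero => exact map_zero _
    | add x y _ _ hx hy => rw [map_add, hx, hy]
  obtain ⟨x, hx⟩ := heff _ ha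
  exact hx (hfix x)

theorem IsRegularAction.of_surjective (hreg : IsRegularAction σ) {B : Type*} [Ring B] [Algebra K B]
    {τ : Torus K n →* (B ≃ₐ[K] B)} {π : A →ₐ[K] B} (hπ : Function.Surjective π)
    (h : ∀ t a, τ t (π a) = π (σ t a)) : IsRegularAction τ := by
  intro b
  obtain ⟨a, rfl⟩ := hπ b
  obtain ⟨c, hc⟩ := hreg a
  refine ⟨c.mapRange π (map_zero π), fun t => ?_⟩
  rw [h, hc, Finsupp.sum_mapRange_index (by simp), Finsupp.sum, Finsupp.sum, map_sum]
  simp only [map_smul]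

/-- The action `t ↦ α⁻¹ ∘ σ t ∘ α`, that is, `σ` in the coordinates given by `α`. -/
def conjAction (σ : Torus K n →* (A ≃ₐ[K] A)) (α : A ≃ₐ[K] A) : Torus K n →* (A ≃ₐ[K] A) :=
  (MulAut.conj α⁻¹).toMonoidHom.comp σ

theorem conjAction_eq (σ : Torus K n →* (A ≃ₐ[K] A)) (α : A ≃ₐ[K] A) (t : Torus K n) :
    conjAction σ α t = α⁻¹ * σ t * α := by
  simp [conjAction]

theorem conjAction_apply (σ : Torus K n →* (A ≃ₐ[K] A)) (α : A ≃ₐ[K] A) (t : Torus K n) (a : A) :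
    conjAction σ α t a = α.symm (σ t (α a)) := by
  rw [conjAction_eq]
  rfl

theorem IsRegularAction.conj (hreg : IsRegularAction σ) (α : A ≃ₐ[K] A) :
    IsRegularAction (conjAction σ α) :=
  hreg.of_surjective (π := α.symm.toAlgHom) α.symm.surjective fun t a => by simp [conjAction_apply]

theorem IsEffectiveAction.conj (heff : IsEffectiveAction σ) (α : A ≃ₐ[K] A) :
    IsEffectiveAction (conjAction σ α) := by
  intro t ht
  obtain ⟨a, ha⟩ := heff t ht
  refine ⟨α.symm a, ?_⟩
  rwa [conjAction_apply, AlgEquiv.apply_symm_apply, Ne, EmbeddingLike.apply_eq_iff_eq]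

end WeightSpaces

theorem IsLinearizable.of_conj {K : Type*} [Field K] {n : ℕ}
    {σ : Torus K n →* (FreeAlgebra K (Fin n) ≃ₐ[K] FreeAlgebra K (Fin n))}
    {α : FreeAlgebra K (Fin n) ≃ₐ[K] FreeAlgebra K (Fin n)}
    (h : IsLinearizable (conjAction σ α)) : IsLinearizable σ := by
  obtain ⟨β, τ, hτ, hβ⟩ := h
  exact ⟨α * β, τ, hτ, fun t => by rw [hβ, conjAction_eq]; group⟩

theorem exists_linearIndependent_of_dotProduct_eq_zero {R : Type*} [CommRing R] [IsDomain R]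
    {n : ℕ} {S : Set (Fin n → R)} (hS : ∀ v, (∀ m ∈ S, m ⬝ᵥ v = 0) → v = 0) :
    ∃ w : Fin n → Fin n → R, LinearIndependent R w ∧ ∀ i, w i ∈ S := by
  obtain ⟨T, hT, hmax⟩ := exists_maximal_linearIndepOn R ((↑) : S → Fin n → R)
  have : Finite T := hT.finite
  have := Fintype.ofFinite T
  have hker : Function.Injective (Matrix.of fun i : T => (i : Fin n → R)).mulVecLin := by
    refine (injective_iff_map_eq_zero _).mpr fun v hv => hS v fun m hm => ?_
    have hTv : Submodule.span R (((↑) : S → Fin n → R) '' T) ≤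
        LinearMap.ker ((dotProductBilin R R).flip v) :=
      Submodule.span_le.mpr (Set.forall_mem_image.mpr fun i hi => congrFun hv ⟨i, hi⟩)
    by_cases hmT : ⟨m, hm⟩ ∈ T
    · exact hTv (Submodule.subset_span ⟨_, hmT, rfl⟩)
    · obtain ⟨a, ha, ham⟩ := hmax _ hmT
      have : a • (m ⬝ᵥ v) = 0 := (smul_dotProduct a m v).symm.trans (hTv ham)
      exact (smul_eq_zero.mp this).resolve_left ha
  obtain ⟨e⟩ := Function.Embedding.nonempty_of_card_le (card_le_of_injective R _ hker)
  exact ⟨fun i => e i, hT.linearIndependent.comp e e.injective, fun i => (e i).1.2⟩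

section GradedAlgebras

theorem finsuppProd_pow_mem_graded {ι M S A : Type*} [AddCommMonoid M] [CommMonoid A] [SetLike S A]
    (𝒜 : M → S) [SetLike.GradedMonoid 𝒜] {w : ι → M} {h : ι → A} (hh : ∀ i, h i ∈ 𝒜 (w i))
    (d : ι →₀ ℕ) : (d.prod fun i k => h i ^ k) ∈ 𝒜 (Finsupp.linearCombination ℕ w d) := by
  induction d using Finsupp.induction_linear with
  | zero => simpa using SetLike.one_mem_graded 𝒜
  | add d d' hd hd' =>
    rw [Finsupp.prod_add_index' (fun _ => pow_zero _) fun _ _ _ => pow_add _ _ _, map_add]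
    exact SetLike.mul_mem_graded hd hd'
  | single i k =>
    rw [Finsupp.prod_single_index (h := fun i k => h i ^ k) (pow_zero _),
      Finsupp.linearCombination_single]
    exact SetLike.pow_mem_graded k (hh i)

variable {ι M K A : Type*} [AddCommGroup M] [DecidableEq M] [Field K] [CommRing A] [IsDomain A]
  [Algebra K A] (𝒜 : M → Submodule K A) [GradedAlgebra 𝒜]

theorem algebraicIndependent_of_mem_graded {w : ι → M} (hw : LinearIndependent ℤ w) {h : ι → A}
    (hh : ∀ i, h i ∈ 𝒜 (w i)) (hh0 : ∀ i, h i ≠ 0) :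
    AlgebraicIndependent (SetLike.GradeZero.subalgebra 𝒜) h := by
  rw [algebraicIndependent_iff]
  intro P hP
  have hwt : Function.Injective (Finsupp.linearCombination ℕ w) :=
    hw.restrict_scalars (R := ℕ) fun a b hab => by simpa using hab
  have hmem (d) : (P.coeff d).1 * (d.prod fun i k => h i ^ k) ∈
      𝒜 (Finsupp.linearCombination ℕ w d) := by
    simpa only [zero_add] using
      SetLike.mul_mem_graded (P.coeff d).2 (finsuppProd_pow_mem_graded 𝒜 hh d)
  have hind := (iSupIndep_iff_finsetSum_eq_zero_imp_eq_zero _).mp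
    ((DirectSum.Decomposition.isInternal 𝒜).submodule_iSupIndep.comp hwt)
  ext1 d
  by_cases hd : d ∈ P.support
  · have hzero := hind P.support _ (fun d _ => hmem d)
      (by rwa [MvPolynomial.aeval_def, MvPolynomial.eval₂_eq] at hP) d hd
    refine Subtype.ext ((mul_eq_zero.mp hzero).resolve_right ?_)
    exact Finset.prod_ne_zero_iff.mpr fun i _ => pow_ne_zero _ (hh0 i)
  · rw [MvPolynomial.notMem_support_iff.mp hd, MvPolynomial.coeff_zero]

theorem isAlgebraic_gradeZero_of_trdeg_le [Fintype ι] {w : ι → M} (hw : LinearIndependent ℤ w)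
    {h : ι → A} (hh : ∀ i, h i ∈ 𝒜 (w i)) (hh0 : ∀ i, h i ≠ 0)
    (htr : Algebra.trdeg K A ≤ Fintype.card ι) :
    (SetLike.GradeZero.subalgebra 𝒜).IsAlgebraic := by
  let A₀ := SetLike.GradeZero.subalgebra 𝒜
  have hle : (Fintype.card ι : Cardinal) ≤ Algebra.trdeg A₀ A := by
    simpa using (algebraicIndependent_of_mem_graded 𝒜 hw hh hh0).lift_cardinalMk_le_trdeg
  have hsum : Algebra.trdeg K A₀ + Fintype.card ι ≤ 0 + Fintype.card ι := by
    rw [zero_add]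
    exact (add_le_add_right hle _).trans ((trdeg_add_eq K A₀ (A := A)).trans_le htr)
  rw [Subalgebra.isAlgebraic_iff, ← trdeg_eq_zero_iff]
  exact le_zero_iff.mp ((Cardinal.add_nat_le_add_nat_iff _).mp hsum)

theorem graded_proj_zero_mul {M K A : Type*} [AddCommGroup M] [DecidableEq M] [CommSemiring K]
    [Semiring A] [Algebra K A] (𝒜 : M → Submodule K A) [GradedAlgebra 𝒜]
    (h : ∀ i ≠ 0, ∀ a ∈ 𝒜 i, ∀ b ∈ 𝒜 (-i), a * b = 0) (a b : A) :
    GradedAlgebra.proj 𝒜 0 (a * b) = GradedAlgebra.proj 𝒜 0 a * GradedAlgebra.proj 𝒜 0 b := by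
  induction a using DirectSum.Decomposition.inductionOn 𝒜 with
  | zero => simp only [zero_mul, map_zero]
  | add a a' ha ha' => simp only [add_mul, map_add, ha, ha']
  | @homogeneous i a =>
    induction b using DirectSum.Decomposition.inductionOn 𝒜 with
    | zero => simp only [mul_zero, map_zero]
    | add b b' hb hb' => simp only [mul_add, map_add, hb, hb']
    | @homogeneous j b =>
      simp only [GradedAlgebra.proj_apply]
      have hab := SetLike.mul_mem_graded a.2 b.2
      rcases eq_or_ne i 0 with rfl | hi
      · rcases eq_or_ne j 0 with rfl | hj
        · rw [add_zero] at hab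
          simp only [DirectSum.decompose_of_mem_same 𝒜 hab, DirectSum.decompose_of_mem_same 𝒜 a.2,
            DirectSum.decompose_of_mem_same 𝒜 b.2]
        · rw [DirectSum.decompose_of_mem_ne 𝒜 b.2 hj, mul_zero]
          exact DirectSum.decompose_of_mem_ne 𝒜 hab (by rwa [zero_add])
      · rw [DirectSum.decompose_of_mem_ne 𝒜 a.2 hi, zero_mul]
        by_cases hij : i + j = 0
        · rw [h i hi a a.2 b (eq_neg_of_add_eq_zero_right hij ▸ b.2)]
          simp
        · exact DirectSum.decompose_of_mem_ne 𝒜 hab hij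

theorem exists_augmentation_of_graded (hunit : ∀ a : A, IsUnit a → a ∈ (⊥ : Subalgebra K A))
    (h0 : (SetLike.GradeZero.subalgebra 𝒜).IsAlgebraic) :
    ∃ ε : A →ₐ[K] K, ∀ i ≠ 0, ∀ a ∈ 𝒜 i, ε a = 0 := by
  have hmul : ∀ i ≠ 0, ∀ a ∈ 𝒜 i, ∀ b ∈ 𝒜 (-i), a * b = 0 := by
    intro i hi a ha b hb
    by_contra hne
    have hab : a * b ∈ 𝒜 0 := add_neg_cancel i ▸ SetLike.mul_mem_graded ha hb
    obtain ⟨c, rfl⟩ := Algebra.mem_bot.mp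
      (hunit a (isUnit_of_mul_isUnit_left ((h0 _ hab).isIntegral.isUnit hne)))
    exact hi (DirectSum.degree_eq_of_mem_mem 𝒜 ha (SetLike.algebraMap_mem_graded 𝒜 c)
      (left_ne_zero_of_mul hne))
  have hconst : ∀ a ∈ 𝒜 0, a ∈ (⊥ : Subalgebra K A) := fun a ha => by
    rcases eq_or_ne a 0 with rfl | ha0
    · exact zero_mem _
    · exact hunit a ((h0 a ha).isIntegral.isUnit ha0)
  let ψ : A →ₐ[K] A := AlgHom.ofLinearMap (GradedAlgebra.proj 𝒜 0)
    (DirectSum.decompose_of_mem_same 𝒜 (SetLike.one_mem_graded 𝒜)) (graded_proj_zero_mul 𝒜 hmul)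
  have hψ : ∀ a, ψ a ∈ (⊥ : Subalgebra K A) := fun a => hconst _ (SetLike.coe_mem _)
  refine ⟨(Algebra.botEquiv K A).toAlgHom.comp (ψ.codRestrict ⊥ hψ), fun i hi a ha => ?_⟩
  have : ψ.codRestrict ⊥ hψ a = 0 := Subtype.ext (DirectSum.decompose_of_mem_ne 𝒜 ha hi)
  exact (congrArg (Algebra.botEquiv K A) this).trans (map_zero _)

end GradedAlgebras

theorem exists_invariant_augmentation {K : Type*} [Field K] [Infinite K] {n : ℕ} {A : Type*}
    [CommRing A] [IsDomain A] [Algebra K A] {σ : Torus K n →* (A ≃ₐ[K] A)}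
    (hreg : IsRegularAction σ) (heff : IsEffectiveAction σ)
    (hunit : ∀ a : A, IsUnit a → a ∈ (⊥ : Subalgebra K A)) (htr : Algebra.trdeg K A ≤ n) :
    ∃ ε : A →ₐ[K] K, ∀ t a, ε (σ t a) = ε a := by
  let := hreg.gradedAlgebra
  obtain ⟨w, hw, hw0⟩ := exists_linearIndependent_of_dotProduct_eq_zero
    (S := {m | weightSpace σ m ≠ ⊥}) fun v => heff.eq_zero_of_dotProduct_eq_zero hreg
  choose h hh hh0 using fun i => (Submodule.ne_bot_iff _).mp (hw0 i)
  obtain ⟨ε, hε⟩ := exists_augmentation_of_graded (weightSpace σ) hunit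
    (isAlgebraic_gradeZero_of_trdeg_le _ hw hh hh0 (by simpa using htr))
  refine ⟨ε, fun t a => ?_⟩
  induction a using DirectSum.Decomposition.inductionOn (weightSpace σ) with
  | zero => simp only [map_zero]
  | add a b ha hb => simp only [map_add, ha, hb]
  | @homogeneous m a =>
    rw [a.2 t, map_smul]
    rcases eq_or_ne m 0 with rfl | hm
    · rw [laurentMonomial_zero, one_smul]
    · rw [hε m hm a a.2, smul_zero]

section Words

variable {X M N : Type*} [AddCommMonoid M] [AddCommMonoid N]

/-- The total weight of a word whose letters carry the weights `w`. -/
def wordWeight (w : X → M) (v : FreeMonoid X) : M := (v.toList.map w).sum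

theorem wordWeight_one (w : X → M) : wordWeight w 1 = 0 := rfl

theorem wordWeight_of_mul (w : X → M) (x : X) (v : FreeMonoid X) :
    wordWeight w (FreeMonoid.of x * v) = w x + wordWeight w v :=
  List.sum_cons

theorem map_wordWeight {F : Type*} [FunLike F M N] [AddMonoidHomClass F M N] (f : F) (w : X → M)
    (v : FreeMonoid X) : f (wordWeight w v) = wordWeight (fun x => f (w x)) v := by
  simp only [wordWeight, map_list_sum, List.map_map, Function.comp_def]

/-- The multiplicities of the letters of a word. -/
noncomputable def wordContent (v : FreeMonoid X) : X →₀ ℕ :=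
  wordWeight (fun x => Finsupp.single x 1) v

theorem toMultiset_wordContent (v : FreeMonoid X) :
    Finsupp.toMultiset (wordContent v) = v.toList := by
  simp only [wordContent, map_wordWeight, Finsupp.toMultiset_single, one_smul]
  exact Multiset.sum_map_singleton (v.toList : Multiset X)

theorem linearCombination_wordContent (w : X → M) (v : FreeMonoid X) :
    Finsupp.linearCombination ℕ w (wordContent v) = wordWeight w v := by
  simp only [wordContent, map_wordWeight, Finsupp.linearCombination_single, one_smul]

theorem perm_of_wordContent_eq {v v' : FreeMonoid X} (h : wordContent v = wordContent v') :
    v.toList.Perm v'.toList := by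
  rw [← Multiset.coe_eq_coe, ← toMultiset_wordContent, h, toMultiset_wordContent]

theorem length_eq_of_wordWeight_eq {w : X → M} (hw : LinearIndependent ℕ w) {v v' : FreeMonoid X}
    (h : wordWeight w v = wordWeight w v') : v.length = v'.length := by
  rw [← linearCombination_wordContent, ← linearCombination_wordContent] at h
  exact (perm_of_wordContent_eq (hw h)).length_eq

end Words

section FreeAlgebras

variable {R X : Type*} [CommRing R]

/-- The product of the generators along a word. -/
def freeWord (R : Type*) [CommRing R] {X : Type*} : FreeMonoid X →* FreeAlgebra R X :=
  FreeMonoid.lift (FreeAlgebra.ι R)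

theorem freeWord_of (x : X) : freeWord R (FreeMonoid.of x) = FreeAlgebra.ι R x :=
  FreeMonoid.lift_eval_of _ x

theorem basisFreeMonoid_apply (v : FreeMonoid X) :
    FreeAlgebra.basisFreeMonoid R X v = freeWord R v := by
  simp [FreeAlgebra.basisFreeMonoid, freeWord, FreeAlgebra.equivMonoidAlgebraFreeMonoid,
    MonoidAlgebra.coeffLinearEquiv]

/-- The coefficient of a noncommutative polynomial at a word. -/
noncomputable def wordCoeff (v : FreeMonoid X) : FreeAlgebra R X →ₗ[R] R :=
  (FreeAlgebra.basisFreeMonoid R X).coord v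

theorem wordCoeff_freeWord [DecidableEq (FreeMonoid X)] (v v' : FreeMonoid X) :
    wordCoeff v (freeWord R v') = if v' = v then 1 else 0 := by
  rw [← basisFreeMonoid_apply, wordCoeff, Basis.coord_apply, Basis.repr_self, Finsupp.single_apply]

theorem linearMap_ext_freeWord {V : Type*} [AddCommGroup V] [Module R V]
    {φ ψ : FreeAlgebra R X →ₗ[R] V} (h : ∀ v, φ (freeWord R v) = ψ (freeWord R v)) : φ = ψ :=
  (FreeAlgebra.basisFreeMonoid R X).ext fun v => by rw [basisFreeMonoid_apply, h]

theorem wordCoeff_one (f : FreeAlgebra R X) : wordCoeff 1 f = FreeAlgebra.algebraMapInv f := by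
  classical
  refine LinearMap.congr_fun (f := wordCoeff 1) (g := FreeAlgebra.algebraMapInv.toLinearMap)
    (linearMap_ext_freeWord fun v => ?_) f
  rw [wordCoeff_freeWord, AlgHom.toLinearMap_apply]
  induction v using FreeMonoid.inductionOn' with
  | one => rw [if_pos rfl, map_one, map_one]
  | of_mul x v _ =>
    have hne : FreeMonoid.of x * v ≠ 1 := List.cons_ne_nil x v.toList
    rw [if_neg hne, map_mul, map_mul, freeWord_of, FreeAlgebra.algebraMapInv,
      FreeAlgebra.lift_ι_apply, Pi.zero_apply, zero_mul]

/-- The noncommutative polynomials without terms of degree less than `k`. -/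
noncomputable def orderFiltration (R : Type*) [CommRing R] (X : Type*) (k : ℕ) :
    Submodule R (FreeAlgebra R X) :=
  Submodule.span R (freeWord R '' {v | k ≤ v.length})

theorem mem_orderFiltration_iff {k : ℕ} {f : FreeAlgebra R X} :
    f ∈ orderFiltration R X k ↔ ∀ v : FreeMonoid X, v.length < k → wordCoeff v f = 0 := by
  have : (freeWord R : FreeMonoid X → FreeAlgebra R X) = FreeAlgebra.basisFreeMonoid R X :=
    funext fun v => (basisFreeMonoid_apply v).symm
  rw [orderFiltration, this, Basis.mem_span_image]
  simp only [Set.subset_def, Finset.mem_coe, Finsupp.mem_support_iff, Set.mem_ofPred_eq]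
  exact forall_congr' fun v => by rw [← not_imp_not, not_le, not_not]; rfl

theorem freeWord_mem_orderFiltration (v : FreeMonoid X) :
    freeWord R v ∈ orderFiltration R X v.length :=
  Submodule.subset_span ⟨v, le_refl v.length, rfl⟩

theorem ι_mem_orderFiltration (x : X) : FreeAlgebra.ι R x ∈ orderFiltration R X 1 := by
  simpa only [freeWord_of, FreeMonoid.length_of] using
    freeWord_mem_orderFiltration (R := R) (FreeMonoid.of x)

theorem orderFiltration_antitone : Antitone (orderFiltration R X) := fun _ _ h =>
  Submodule.span_mono (Set.image_mono fun _ hv => h.trans hv)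

theorem mul_mem_orderFiltration {k l : ℕ} {f g : FreeAlgebra R X} (hf : f ∈ orderFiltration R X k)
    (hg : g ∈ orderFiltration R X l) : f * g ∈ orderFiltration R X (k + l) := by
  have h := Submodule.mul_mem_mul hf hg
  rw [orderFiltration, orderFiltration, Submodule.span_mul_span] at h
  refine Submodule.span_mono ?_ h
  rintro _ ⟨_, ⟨v, hv, rfl⟩, _, ⟨v', hv', rfl⟩, rfl⟩
  exact ⟨v * v', (add_le_add hv hv').trans_eq (FreeMonoid.length_mul v v').symm, map_mul _ _ _⟩

theorem mem_orderFiltration_one_iff {f : FreeAlgebra R X} :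
    f ∈ orderFiltration R X 1 ↔ FreeAlgebra.algebraMapInv f = 0 := by
  simp only [mem_orderFiltration_iff, Nat.lt_one_iff, FreeMonoid.length_eq_zero, forall_eq,
    wordCoeff_one]

theorem exists_lowest_word {f : FreeAlgebra R X} (hf : f ≠ 0) :
    ∃ v : FreeMonoid X, f ∈ orderFiltration R X v.length ∧ wordCoeff v f ≠ 0 := by
  have hne : ∃ v : FreeMonoid X, wordCoeff v f ≠ 0 := by
    by_contra! h
    exact hf ((FreeAlgebra.basisFreeMonoid R X).forall_coord_eq_zero_iff.mp h)
  obtain ⟨v, hv, hmin⟩ :=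
    exists_minimalFor_of_wellFoundedLT (wordCoeff · f ≠ 0) FreeMonoid.length hne
  refine ⟨v, mem_orderFiltration_iff.mpr fun v' hv' => ?_, hv⟩
  by_contra h
  exact hv'.not_ge (hmin h hv'.le)

theorem map_mem_orderFiltration {φ : FreeAlgebra R X →ₐ[R] FreeAlgebra R X}
    (hφ : ∀ x, φ (FreeAlgebra.ι R x) ∈ orderFiltration R X 1) {k : ℕ} {f : FreeAlgebra R X}
    (hf : f ∈ orderFiltration R X k) : φ f ∈ orderFiltration R X k := by
  have hword (v : FreeMonoid X) : φ (freeWord R v) ∈ orderFiltration R X v.length := by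
    induction v using FreeMonoid.inductionOn' with
    | one => simpa using freeWord_mem_orderFiltration (R := R) (1 : FreeMonoid X)
    | of_mul x v ih =>
      rw [map_mul, map_mul, freeWord_of, FreeMonoid.length_mul, FreeMonoid.length_of]
      exact mul_mem_orderFiltration (hφ x) ih
  suffices h : orderFiltration R X k ≤ (orderFiltration R X k).comap φ.toLinearMap from h hf
  refine Submodule.span_le.mpr (Set.image_subset_iff.mpr fun v hv => ?_)
  exact orderFiltration_antitone hv (hword v)

theorem map_sub_map_mem_orderFiltration {φ ψ : FreeAlgebra R X →ₐ[R] FreeAlgebra R X}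
    (hψ : ∀ x, ψ (FreeAlgebra.ι R x) ∈ orderFiltration R X 1)
    (h : ∀ x, φ (FreeAlgebra.ι R x) - ψ (FreeAlgebra.ι R x) ∈ orderFiltration R X 2) {k : ℕ}
    {f : FreeAlgebra R X} (hf : f ∈ orderFiltration R X k) :
    φ f - ψ f ∈ orderFiltration R X (k + 1) := by
  have hφ (x : X) : φ (FreeAlgebra.ι R x) ∈ orderFiltration R X 1 := by
    simpa only [sub_add_cancel] using add_mem (orderFiltration_antitone one_le_two (h x)) (hψ x)
  have hword (v : FreeMonoid X) :
      φ (freeWord R v) - ψ (freeWord R v) ∈ orderFiltration R X (v.length + 1) := by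
    induction v using FreeMonoid.inductionOn' with
    | one => simp only [map_one, sub_self, zero_mem]
    | of_mul x v ih =>
      have hψv := map_mem_orderFiltration hψ (freeWord_mem_orderFiltration (R := R) v)
      rw [FreeMonoid.length_mul, FreeMonoid.length_of, map_mul, map_mul, map_mul, freeWord_of,
        ← sub_add_sub_cancel _ (φ (FreeAlgebra.ι R x) * ψ (freeWord R v)), ← mul_sub, ← sub_mul]
      exact add_mem ((add_assoc 1 v.length 1).symm ▸ mul_mem_orderFiltration (hφ x) ih)
        (add_right_comm 1 1 v.length ▸ mul_mem_orderFiltration (h x) hψv)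
  suffices h : orderFiltration R X k ≤
      (orderFiltration R X (k + 1)).comap (φ.toLinearMap - ψ.toLinearMap) from h hf
  refine Submodule.span_le.mpr (Set.image_subset_iff.mpr fun v hv => ?_)
  exact orderFiltration_antitone (Nat.succ_le_succ hv) (hword v)

theorem wordCoeff_map {φ : FreeAlgebra R X →ₐ[R] FreeAlgebra R X} {c : X → R}
    (hφ : ∀ x, φ (FreeAlgebra.ι R x) - c x • FreeAlgebra.ι R x ∈ orderFiltration R X 2)
    {v : FreeMonoid X} {f : FreeAlgebra R X} (hf : f ∈ orderFiltration R X v.length) :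
    wordCoeff v (φ f) = FreeMonoid.lift c v * wordCoeff v f := by
  classical
  let δ : FreeAlgebra R X →ₐ[R] FreeAlgebra R X :=
    FreeAlgebra.lift R fun x => c x • FreeAlgebra.ι R x
  have hδι (x : X) : δ (FreeAlgebra.ι R x) = c x • FreeAlgebra.ι R x :=
    FreeAlgebra.lift_ι_apply _ x
  have hδ (v : FreeMonoid X) : δ (freeWord R v) = FreeMonoid.lift c v • freeWord R v := by
    induction v using FreeMonoid.inductionOn' with
    | one => simp only [map_one, one_smul]
    | of_mul x v ih =>
      simp only [map_mul, freeWord_of, FreeMonoid.lift_eval_of, hδι, ih, smul_mul_smul_comm]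
  have hcoeff : wordCoeff v ∘ₗ δ.toLinearMap = FreeMonoid.lift c v • wordCoeff v := by
    refine linearMap_ext_freeWord fun v' => ?_
    simp only [LinearMap.comp_apply, AlgHom.toLinearMap_apply, hδ, map_smul, wordCoeff_freeWord,
      LinearMap.smul_apply, smul_eq_mul]
    split_ifs with h
    · rw [h]
    · simp only [mul_zero]
  have hlow : wordCoeff v (φ f - δ f) = 0 :=
    mem_orderFiltration_iff.mp (map_sub_map_mem_orderFiltration
      (fun x => hδι x ▸ Submodule.smul_mem _ _ (ι_mem_orderFiltration x))
      (fun x => hδι x ▸ hφ x) hf) v (Nat.lt_succ_self _)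
  rw [map_sub, sub_eq_zero] at hlow
  exact hlow.trans (LinearMap.congr_fun hcoeff f)

theorem wordCoeff_map_of_sub_mem {φ : FreeAlgebra R X →ₐ[R] FreeAlgebra R X}
    (hφ : ∀ x, φ (FreeAlgebra.ι R x) - FreeAlgebra.ι R x ∈ orderFiltration R X 2)
    {v : FreeMonoid X} {f : FreeAlgebra R X} (hf : f ∈ orderFiltration R X v.length) :
    wordCoeff v (φ f) = wordCoeff v f := by
  have h1 : FreeMonoid.lift (fun _ : X => (1 : R)) = 1 := FreeMonoid.hom_eq fun _ => by simp
  simpa [h1] using wordCoeff_map (c := fun _ => 1) (by simpa using hφ) hf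

theorem injective_of_sub_mem_orderFiltration {φ : FreeAlgebra R X →ₐ[R] FreeAlgebra R X}
    (hφ : ∀ x, φ (FreeAlgebra.ι R x) - FreeAlgebra.ι R x ∈ orderFiltration R X 2) :
    Function.Injective φ := by
  refine (injective_iff_map_eq_zero φ).mpr fun f hf => ?_
  by_contra hne
  obtain ⟨v, hv, hv0⟩ := exists_lowest_word hne
  rw [← wordCoeff_map_of_sub_mem hφ hv, hf, map_zero] at hv0
  exact hv0 rfl

/-- The map from the free algebra to commutative polynomials. -/
noncomputable def abelianization (R : Type*) [CommRing R] (X : Type*) :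
    FreeAlgebra R X →ₐ[R] MvPolynomial X R :=
  FreeAlgebra.lift R MvPolynomial.X

theorem abelianization_ι (x : X) :
    abelianization R X (FreeAlgebra.ι R x) = MvPolynomial.X x :=
  FreeAlgebra.lift_ι_apply _ x

theorem abelianization_freeWord (v : FreeMonoid X) :
    abelianization R X (freeWord R v) = MvPolynomial.monomial (wordContent v) 1 := by
  induction v using FreeMonoid.inductionOn' with
  | one => simp only [map_one, wordContent, wordWeight_one]; rfl
  | of_mul x v ih =>
    rw [map_mul, map_mul, freeWord_of, abelianization_ι, ih, wordContent, wordContent,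
      wordWeight_of_mul, MvPolynomial.X, MvPolynomial.monomial_mul, one_mul]

theorem abelianization_surjective : Function.Surjective (abelianization R X) := by
  rw [← AlgHom.range_eq_top, eq_top_iff, ← MvPolynomial.adjoin_range_X, Algebra.adjoin_le_iff]
  rintro _ ⟨x, rfl⟩
  exact ⟨_, abelianization_ι x⟩

theorem wordCoeff_eq_coeff_abelianization {v : FreeMonoid X} (hv : v.length ≤ 1)
    (f : FreeAlgebra R X) :
    wordCoeff v f = MvPolynomial.coeff (wordContent v) (abelianization R X f) := by
  classical
  have hcontent (v' : FreeMonoid X) : v' = v ↔ wordContent v' = wordContent v := by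
    refine ⟨congrArg _, fun h => ?_⟩
    have hperm := perm_of_wordContent_eq h
    match v, v', hv, hperm with
    | [], _, _, hperm => exact hperm.eq_nil
    | [x], _, _, hperm => exact hperm.eq_singleton
  refine LinearMap.congr_fun (f := wordCoeff v) (g := MvPolynomial.lcoeff R (wordContent v) ∘ₗ
    (abelianization R X).toLinearMap) (linearMap_ext_freeWord fun v' => ?_) f
  simp only [wordCoeff_freeWord, LinearMap.comp_apply, AlgHom.toLinearMap_apply,
    abelianization_freeWord, MvPolynomial.lcoeff_apply, MvPolynomial.coeff_monomial, hcontent]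

theorem mem_orderFiltration_two_of_abelianization_eq_zero {f : FreeAlgebra R X}
    (hf : abelianization R X f = 0) : f ∈ orderFiltration R X 2 :=
  mem_orderFiltration_iff.mpr fun v hv => by
    rw [wordCoeff_eq_coeff_abelianization (Nat.le_of_lt_succ hv), hf, MvPolynomial.coeff_zero]

end FreeAlgebras

section LinearParts

variable {R X : Type*} [CommRing R]

/-- The part of degree one of a noncommutative polynomial, given by its coefficients. -/
noncomputable def linearPart : FreeAlgebra R X →ₗ[R] X →₀ R :=
  Finsupp.lcomapDomain FreeMonoid.of FreeMonoid.of_injective ∘ₗ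
    (FreeAlgebra.basisFreeMonoid R X).repr.toLinearMap

theorem linearPart_apply (f : FreeAlgebra R X) (x : X) :
    linearPart f x = wordCoeff (FreeMonoid.of x) f := rfl

theorem linearPart_ι (x : X) :
    linearPart (FreeAlgebra.ι R x) = Finsupp.single x 1 := by
  classical
  ext y
  rw [linearPart_apply, ← freeWord_of, wordCoeff_freeWord, Finsupp.single_apply,
    FreeMonoid.of_injective.eq_iff]

theorem linearPart_algebraMap (c : R) :
    linearPart (algebraMap R (FreeAlgebra R X) c) = 0 := by
  classical
  ext x
  rw [Algebra.algebraMap_eq_smul_one, map_smul, ← map_one (freeWord R), Finsupp.smul_apply,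
    linearPart_apply, wordCoeff_freeWord, if_neg (FreeMonoid.of_ne_one x).symm, smul_zero,
    Finsupp.zero_apply]

theorem mem_orderFiltration_two_of_linearPart_eq_zero {f : FreeAlgebra R X}
    (hf : f ∈ orderFiltration R X 1) (hf' : linearPart f = 0) : f ∈ orderFiltration R X 2 := by
  refine mem_orderFiltration_iff.mpr fun v hv => ?_
  rcases (Nat.le_of_lt_succ hv).lt_or_eq with hv | hv
  · exact mem_orderFiltration_iff.mp hf v hv
  · obtain ⟨x, rfl⟩ := FreeMonoid.length_eq_one.mp hv
    rw [← linearPart_apply, hf', Finsupp.zero_apply]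

theorem linearCombination_ι_mem_orderFiltration (a : X →₀ R) :
    Finsupp.linearCombination R (FreeAlgebra.ι R) a ∈ orderFiltration R X 1 :=
  Submodule.sum_smul_mem _ _ fun x _ => ι_mem_orderFiltration x

theorem linearPart_linearCombination_ι (a : X →₀ R) :
    linearPart (Finsupp.linearCombination R (FreeAlgebra.ι R) a) = a := by
  simp only [Finsupp.linearCombination_apply, Finsupp.sum, map_sum, map_smul, linearPart_ι,
    Finsupp.smul_single_one]
  exact a.sum_single

/-- The linear change of coordinates taking the generators to the linear forms with coefficient
vectors `b x`. -/
noncomputable def linearAut (b : Basis X R (X →₀ R)) : FreeAlgebra R X ≃ₐ[R] FreeAlgebra R X :=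
  (TensorAlgebra.equivFreeAlgebra b).symm.trans
    (TensorAlgebra.equivFreeAlgebra Finsupp.basisSingleOne)

theorem linearAut_ι (b : Basis X R (X →₀ R)) (x : X) :
    linearAut b (FreeAlgebra.ι R x) = Finsupp.linearCombination R (FreeAlgebra.ι R) (b x) := by
  simp [linearAut, TensorAlgebra.equivFreeAlgebra]

theorem linearAut_symm_ι (b : Basis X R (X →₀ R)) (x : X) :
    (linearAut b).symm (FreeAlgebra.ι R x) =
      Finsupp.linearCombination R (FreeAlgebra.ι R) (b.repr (Finsupp.single x 1)) := by
  simp [linearAut, TensorAlgebra.equivFreeAlgebra]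

theorem linearAut_symm_mem_orderFiltration (b : Basis X R (X →₀ R)) {k : ℕ} {f : FreeAlgebra R X}
    (hf : f ∈ orderFiltration R X k) : (linearAut b).symm f ∈ orderFiltration R X k :=
  map_mem_orderFiltration (φ := (linearAut b).symm.toAlgHom)
    (fun x => linearAut_symm_ι b x ▸ linearCombination_ι_mem_orderFiltration _) hf

theorem algebraMapInv_linearAut (b : Basis X R (X →₀ R)) (f : FreeAlgebra R X) :
    FreeAlgebra.algebraMapInv (linearAut b f) = FreeAlgebra.algebraMapInv f := by
  refine DFunLike.congr_fun (f := FreeAlgebra.algebraMapInv.comp (linearAut b).toAlgHom)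
    (FreeAlgebra.hom_ext (funext fun x => ?_)) f
  have h := mem_orderFiltration_one_iff.mp (linearCombination_ι_mem_orderFiltration (b x))
  rw [← linearAut_ι] at h
  exact h.trans (mem_orderFiltration_one_iff.mp (ι_mem_orderFiltration x)).symm

theorem linearAut_symm_sub_ι_mem (b : Basis X R (X →₀ R)) {u : FreeAlgebra R X} {x : X}
    (hu : u ∈ orderFiltration R X 1) (hux : linearPart u = b x) :
    (linearAut b).symm u - FreeAlgebra.ι R x ∈ orderFiltration R X 2 := by
  rw [← (linearAut b).symm_apply_apply (FreeAlgebra.ι R x), ← map_sub, linearAut_ι]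
  refine linearAut_symm_mem_orderFiltration b (mem_orderFiltration_two_of_linearPart_eq_zero
    (sub_mem hu (linearCombination_ι_mem_orderFiltration _)) ?_)
  rw [map_sub, linearPart_linearCombination_ι, hux, sub_self]

/-- The automorphism of the free algebra translating the generators by scalars. -/
noncomputable def translationAut (c : X → R) : FreeAlgebra R X ≃ₐ[R] FreeAlgebra R X :=
  AlgEquiv.ofAlgHom
    (FreeAlgebra.lift R fun x => FreeAlgebra.ι R x + algebraMap R _ (c x))
    (FreeAlgebra.lift R fun x => FreeAlgebra.ι R x - algebraMap R _ (c x))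
    (by ext x; simp) (by ext x; simp)

theorem translationAut_ι (c : X → R) (x : X) :
    translationAut c (FreeAlgebra.ι R x) = FreeAlgebra.ι R x + algebraMap R _ (c x) :=
  FreeAlgebra.lift_ι_apply _ _

theorem comp_translationAut (ε : FreeAlgebra R X →ₐ[R] R)
    (f : FreeAlgebra R X) :
    ε (translationAut (fun x => -ε (FreeAlgebra.ι R x)) f) = FreeAlgebra.algebraMapInv f := by
  refine DFunLike.congr_fun (f := ε.comp (translationAut _).toAlgHom)
    (FreeAlgebra.hom_ext (funext fun x => ?_)) f
  simp [translationAut_ι, FreeAlgebra.algebraMapInv]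

end LinearParts

section TangentWeights

variable {K X : Type*} [Field K] {n : ℕ} {σ : Torus K n →* (FreeAlgebra K X ≃ₐ[K] FreeAlgebra K X)}

/-- The action preserves constant terms: geometrically, the origin is a fixed point. -/
def FixesOrigin (σ : Torus K n →* (FreeAlgebra K X ≃ₐ[K] FreeAlgebra K X)) : Prop :=
  ∀ t f, FreeAlgebra.algebraMapInv (σ t f) = FreeAlgebra.algebraMapInv f

theorem fixesOrigin_conjAction {ε : FreeAlgebra K X →ₐ[K] K} (hε : ∀ t f, ε (σ t f) = ε f)
    {α : FreeAlgebra K X ≃ₐ[K] FreeAlgebra K X}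
    (hα : ∀ f, ε (α f) = FreeAlgebra.algebraMapInv f) : FixesOrigin (conjAction σ α) :=
  fun t f => by rw [← hα, conjAction_apply, AlgEquiv.apply_symm_apply, hε, hα]

theorem FixesOrigin.map_mem_orderFiltration (hσ : FixesOrigin σ) (t : Torus K n) {k : ℕ}
    {f : FreeAlgebra K X} (hf : f ∈ orderFiltration K X k) : σ t f ∈ orderFiltration K X k := by
  refine FreeTorus.map_mem_orderFiltration (φ := (σ t).toAlgHom) (fun x => ?_) hf
  exact mem_orderFiltration_one_iff.mpr
    ((hσ t _).trans (mem_orderFiltration_one_iff.mp (ι_mem_orderFiltration x)))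

theorem FixesOrigin.exists_weightVectors [Infinite K] (hσ : FixesOrigin σ)
    (hreg : IsRegularAction σ) :
    ∃ (b : Basis X K (X →₀ K)) (w : X → Fin n → ℤ) (u : X → FreeAlgebra K X),
      ∀ x, u x ∈ weightSpace σ (w x) ∧ u x ∈ orderFiltration K X 1 ∧ linearPart (u x) = b x := by
  let S : Set (X →₀ K) :=
    {a | ∃ m, ∃ f ∈ weightSpace σ m, f ∈ orderFiltration K X 1 ∧ linearPart f = a}
  have hweight (m) : weightSpace σ m ≤ (Submodule.span K S).comap linearPart := by
    intro f hf
    let c := FreeAlgebra.algebraMapInv f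
    have hc (t : Torus K n) : laurentMonomial m t * c = c := by
      rw [← smul_eq_mul, ← map_smul, ← hf t, hσ t]
    refine Submodule.subset_span ⟨m, f - algebraMap K _ c, fun t => ?_, ?_, ?_⟩
    · rw [map_sub, AlgEquiv.commutes, hf t, smul_sub, Algebra.smul_def _ (algebraMap K _ c),
        ← map_mul, hc]
    · rw [mem_orderFiltration_one_iff, map_sub, AlgHom.commutes]
      exact sub_self c
    · rw [map_sub, linearPart_algebraMap, sub_zero]
  have hS : ⊤ ≤ Submodule.span K S := by
    have htop := iSup_le hweight
    rw [hreg.iSup_weightSpace_eq_top] at htop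
    rw [← Finsupp.basisSingleOne.span_eq, Submodule.span_le]
    rintro _ ⟨x, rfl⟩
    have hx : linearPart (FreeAlgebra.ι K x) ∈ Submodule.span K S := htop Submodule.mem_top
    rwa [linearPart_ι] at hx
  let e := (Basis.ofSpan hS).indexEquiv (Finsupp.basisSingleOne (R := K) (ι := X))
  let b := (Basis.ofSpan hS).reindex e
  have hb (x : X) : b x ∈ S := by
    rw [Basis.reindex_apply]
    exact Basis.ofSpan_subset hS ⟨_, rfl⟩
  choose w u hu using hb
  exact ⟨b, w, u, hu⟩

/-- The linear parts of the action are diagonal, with weights `w`: the generators are tangent to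
weight vectors at the origin. -/
def HasTangentWeights (σ : Torus K n →* (FreeAlgebra K X ≃ₐ[K] FreeAlgebra K X))
    (w : X → Fin n → ℤ) : Prop :=
  ∀ t x, σ t (FreeAlgebra.ι K x) - laurentMonomial (w x) t • FreeAlgebra.ι K x ∈
    orderFiltration K X 2

variable {w : X → Fin n → ℤ} {u : X → FreeAlgebra K X}

theorem FixesOrigin.hasTangentWeights (hσ : FixesOrigin σ) (hu : ∀ x, u x ∈ weightSpace σ (w x))
    (hu2 : ∀ x, u x - FreeAlgebra.ι K x ∈ orderFiltration K X 2) : HasTangentWeights σ w := by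
  intro t x
  have h := sub_mem (Submodule.smul_mem _ (laurentMonomial (w x) t) (hu2 x))
    (hσ.map_mem_orderFiltration t (hu2 x))
  rwa [map_sub, hu x t, smul_sub, sub_sub_sub_cancel_left] at h

theorem laurentMonomial_wordWeight (w : X → Fin n → ℤ) (v : FreeMonoid X) (t : Torus K n) :
    laurentMonomial (wordWeight w v) t = FreeMonoid.lift (fun x => laurentMonomial (w x) t) v := by
  induction v using FreeMonoid.inductionOn' with
  | one => rw [wordWeight_one, laurentMonomial_zero, map_one]
  | of_mul x v ih =>
    rw [wordWeight_of_mul, laurentMonomial_add, ih, map_mul, FreeMonoid.lift_eval_of]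

theorem HasTangentWeights.wordWeight_eq [Infinite K] (hw : HasTangentWeights σ w)
    {m : Fin n → ℤ} {f : FreeAlgebra K X} (hf : f ∈ weightSpace σ m) {v : FreeMonoid X}
    (hfv : f ∈ orderFiltration K X v.length) (hv : wordCoeff v f ≠ 0) : wordWeight w v = m := by
  refine laurentCharacter_injective (K := K) (MonoidHom.ext fun t => ?_)
  have h := wordCoeff_map (φ := (σ t).toAlgHom) (hw t) hfv
  rw [← laurentMonomial_wordWeight] at h
  refine mul_right_cancel₀ hv (h.symm.trans ?_)
  exact (congrArg (wordCoeff v) (hf t)).trans (map_smul _ _ _)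

theorem HasTangentWeights.exists_wordWeight_eq [Infinite K] (hw : HasTangentWeights σ w)
    {m : Fin n → ℤ} {f : FreeAlgebra K X} (hf : f ∈ weightSpace σ m) (hf0 : f ≠ 0) :
    ∃ v, wordWeight w v = m ∧ wordCoeff v f ≠ 0 := by
  obtain ⟨v, hfv, hv⟩ := exists_lowest_word hf0
  exact ⟨v, hw.wordWeight_eq hf hfv hv, hv⟩

theorem lift_freeWord_mem_weightSpace (hu : ∀ x, u x ∈ weightSpace σ (w x)) (v : FreeMonoid X) :
    FreeAlgebra.lift K u (freeWord K v) ∈ weightSpace σ (wordWeight w v) := by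
  induction v using FreeMonoid.inductionOn' with
  | one =>
    rw [map_one, map_one]
    exact SetLike.one_mem_graded (weightSpace σ)
  | of_mul x v ih =>
    rw [map_mul, map_mul, freeWord_of, FreeAlgebra.lift_ι_apply, wordWeight_of_mul]
    exact SetLike.mul_mem_graded (hu x) ih

theorem HasTangentWeights.lift_surjective [Infinite K] (hw : HasTangentWeights σ w)
    (hreg : IsRegularAction σ) (hli : LinearIndependent ℕ w)
    (hu : ∀ x, u x ∈ weightSpace σ (w x))
    (hu2 : ∀ x, u x - FreeAlgebra.ι K x ∈ orderFiltration K X 2) :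
    Function.Surjective (FreeAlgebra.lift K u) := by
  classical
  suffices h : ∀ m, weightSpace σ m ≤ LinearMap.range (FreeAlgebra.lift K u).toLinearMap by
    have htop := iSup_le h
    rw [hreg.iSup_weightSpace_eq_top] at htop
    exact fun f => htop Submodule.mem_top
  intro m f hf
  let s := ((FreeAlgebra.basisFreeMonoid K X).repr f).support.filter (wordWeight w · = m)
  let g := ∑ v ∈ s, wordCoeff v f • freeWord K v
  have hg : FreeAlgebra.lift K u g ∈ weightSpace σ m := by
    rw [map_sum]
    refine Submodule.sum_mem _ fun v hv => ?_
    rw [map_smul, ← (Finset.mem_filter.mp hv).2]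
    exact Submodule.smul_mem _ _ (lift_freeWord_mem_weightSpace hu v)
  have hcoeff (v) (hv : wordWeight w v = m) :
      wordCoeff v (FreeAlgebra.lift K u g) = wordCoeff v f := by
    have hgv : g ∈ orderFiltration K X v.length := by
      refine Submodule.sum_mem _ fun v' hv' => Submodule.smul_mem _ _ ?_
      rw [length_eq_of_wordWeight_eq hli (hv.trans (Finset.mem_filter.mp hv').2.symm)]
      exact freeWord_mem_orderFiltration v'
    rw [wordCoeff_map_of_sub_mem (by simpa only [FreeAlgebra.lift_ι_apply] using hu2) hgv]
    simp only [g, s, map_sum, map_smul, wordCoeff_freeWord, smul_eq_mul, mul_ite, mul_one, mul_zero,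
      Finset.sum_ite_eq', Finset.mem_filter, hv, and_true, Finsupp.mem_support_iff, ite_not]
    exact ite_eq_right_iff.mpr Eq.symm
  refine ⟨g, ?_⟩
  by_contra hne
  obtain ⟨v, hv, hv0⟩ := hw.exists_wordWeight_eq (sub_mem hg hf) (sub_ne_zero.mpr hne)
  exact hv0 (by rw [map_sub, hcoeff v hv, sub_self])

theorem HasTangentWeights.linearIndependent [Infinite K]
    {σ : Torus K n →* (FreeAlgebra K (Fin n) ≃ₐ[K] FreeAlgebra K (Fin n))} {w : Fin n → Fin n → ℤ}
    (hw : HasTangentWeights σ w) (hreg : IsRegularAction σ) (heff : IsEffectiveAction σ) :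
    LinearIndependent ℤ w := by
  refine Matrix.linearIndependent_rows_of_det_ne_zero (A := Matrix.of w) fun hdet => ?_
  obtain ⟨v, hv0, hv⟩ := Matrix.exists_mulVec_eq_zero_iff.mpr hdet
  refine hv0 (heff.eq_zero_of_dotProduct_eq_zero hreg fun m hm => ?_)
  obtain ⟨f, hf, hf0⟩ := (Submodule.ne_bot_iff _).mp hm
  obtain ⟨x, rfl, -⟩ := hw.exists_wordWeight_eq hf hf0
  have hwv (i) : w i ⬝ᵥ v = 0 := congrFun hv i
  calc wordWeight w x ⬝ᵥ v = wordWeight (fun i => w i ⬝ᵥ v) x :=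
        map_wordWeight ((dotProductBilin ℤ ℤ).flip v) w x
    _ = 0 := by simp only [hwv, wordWeight, List.map_const', List.sum_replicate, smul_zero]

theorem HasTangentWeights.isLinearizable [Infinite K]
    {σ : Torus K n →* (FreeAlgebra K (Fin n) ≃ₐ[K] FreeAlgebra K (Fin n))} {w : Fin n → Fin n → ℤ}
    (hw : HasTangentWeights σ w) (hreg : IsRegularAction σ) (heff : IsEffectiveAction σ)
    {u : Fin n → FreeAlgebra K (Fin n)} (hu : ∀ i, u i ∈ weightSpace σ (w i))
    (hu2 : ∀ i, u i - FreeAlgebra.ι K i ∈ orderFiltration K (Fin n) 2) : IsLinearizable σ := by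
  have hli : LinearIndependent ℕ w := (hw.linearIndependent hreg heff).restrict_scalars
    fun a b hab => by simpa using hab
  let β := AlgEquiv.ofBijective (FreeAlgebra.lift K u)
    ⟨injective_of_sub_mem_orderFiltration (by simpa using hu2),
      hw.lift_surjective hreg hli hu hu2⟩
  have hβ (i) : β (FreeAlgebra.ι K i) = u i := FreeAlgebra.lift_ι_apply _ _
  refine ⟨β, conjAction σ β, ⟨w, fun t i => ?_⟩, conjAction_eq σ β⟩
  rw [conjAction_apply, hβ, hu i t, map_smul, ← hβ, AlgEquiv.symm_apply_apply]

theorem FixesOrigin.isLinearizable [Infinite K]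
    {σ : Torus K n →* (FreeAlgebra K (Fin n) ≃ₐ[K] FreeAlgebra K (Fin n))} (hσ : FixesOrigin σ)
    (hreg : IsRegularAction σ) (heff : IsEffectiveAction σ) : IsLinearizable σ := by
  obtain ⟨b, w, u, hu⟩ := hσ.exists_weightVectors hreg
  let α := linearAut b
  have hσα : FixesOrigin (conjAction σ α) := fixesOrigin_conjAction hσ (algebraMapInv_linearAut b)
  have hwt (i) : α.symm (u i) ∈ weightSpace (conjAction σ α) (w i) := fun t => by
    rw [conjAction_apply, AlgEquiv.apply_symm_apply, (hu i).1 t, map_smul]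
  have htan (i) : α.symm (u i) - FreeAlgebra.ι K i ∈ orderFiltration K (Fin n) 2 :=
    linearAut_symm_sub_ι_mem b (hu i).2.1 (hu i).2.2
  exact ((hσα.hasTangentWeights hwt htan).isLinearizable
    (hreg.conj α) (heff.conj α) hwt htan).of_conj

end TangentWeights

section FixedPoints

/-- The endomorphism of the commutative polynomial algebra induced by an endomorphism of the free
algebra. -/
noncomputable def abelianizedEnd {R X : Type*} [CommRing R]
    (φ : FreeAlgebra R X →ₐ[R] FreeAlgebra R X) : MvPolynomial X R →ₐ[R] MvPolynomial X R :=
  MvPolynomial.aeval fun x => abelianization R X (φ (FreeAlgebra.ι R x))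

theorem abelianizedEnd_abelianization {R X : Type*} [CommRing R]
    (φ : FreeAlgebra R X →ₐ[R] FreeAlgebra R X) (f : FreeAlgebra R X) :
    abelianizedEnd φ (abelianization R X f) = abelianization R X (φ f) := by
  refine DFunLike.congr_fun (f := (abelianizedEnd φ).comp (abelianization R X))
    (g := (abelianization R X).comp φ) (FreeAlgebra.hom_ext (funext fun x => ?_)) f
  simp [abelianizedEnd, abelianization_ι]

variable {K X : Type*} [Field K] {n : ℕ} {σ : Torus K n →* (FreeAlgebra K X ≃ₐ[K] FreeAlgebra K X)}

/-- The action on commutative polynomials induced by an action on the free algebra. -/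
noncomputable def abelianizedAction (σ : Torus K n →* (FreeAlgebra K X ≃ₐ[K] FreeAlgebra K X)) :
    Torus K n →* (MvPolynomial X K ≃ₐ[K] MvPolynomial X K) :=
  (AlgEquiv.algHomUnitsEquiv K (MvPolynomial X K)).toMonoidHom.comp <| MonoidHom.toHomUnits
    { toFun := fun t => abelianizedEnd (σ t).toAlgHom
      map_one' := MvPolynomial.algHom_ext fun x => by simp [abelianizedEnd, abelianization_ι]
      map_mul' := fun s t => by
        refine (AlgHom.cancel_right abelianization_surjective).mp (AlgHom.ext fun f => ?_)
        simp [abelianizedEnd_abelianization] }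

theorem abelianizedAction_abelianization
    (σ : Torus K n →* (FreeAlgebra K X ≃ₐ[K] FreeAlgebra K X)) (t : Torus K n)
    (f : FreeAlgebra K X) :
    abelianizedAction σ t (abelianization K X f) = abelianization K X (σ t f) :=
  abelianizedEnd_abelianization (σ t).toAlgHom f

theorem IsRegularAction.abelianizedAction (hreg : IsRegularAction σ) :
    IsRegularAction (abelianizedAction σ) :=
  hreg.of_surjective abelianization_surjective (abelianizedAction_abelianization σ)

theorem IsEffectiveAction.abelianizedAction [Infinite K] (heff : IsEffectiveAction σ)
    (hreg : IsRegularAction σ) : IsEffectiveAction (abelianizedAction σ) := by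
  intro t ht
  by_contra! htriv
  have htan (x : X) : σ t (FreeAlgebra.ι K x) - FreeAlgebra.ι K x ∈ orderFiltration K X 2 := by
    refine mem_orderFiltration_two_of_abelianization_eq_zero ?_
    rw [map_sub, ← abelianizedAction_abelianization, htriv, sub_self]
  have hfix : ⨆ m, weightSpace σ m ≤ LinearMap.eqLocus (σ t).toLinearMap LinearMap.id := by
    refine iSup_le fun m f hf => ?_
    rcases eq_or_ne f 0 with rfl | hf0
    · exact zero_mem _
    obtain ⟨v, hfv, hv⟩ := exists_lowest_word hf0
    have h : wordCoeff v (σ t f) = wordCoeff v f :=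
      wordCoeff_map_of_sub_mem (φ := (σ t).toAlgHom) htan hfv
    rw [hf t, map_smul, smul_eq_mul, mul_eq_right₀ hv] at h
    exact (hf t).trans (by rw [h, one_smul]; rfl)
  rw [hreg.iSup_weightSpace_eq_top] at hfix
  obtain ⟨f, hf⟩ := heff t ht
  exact hf (hfix (Submodule.mem_top (x := f)))

theorem exists_invariant_augmentation_freeAlgebra [Infinite K]
    {σ : Torus K n →* (FreeAlgebra K (Fin n) ≃ₐ[K] FreeAlgebra K (Fin n))}
    (hreg : IsRegularAction σ) (heff : IsEffectiveAction σ) :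
    ∃ ε : FreeAlgebra K (Fin n) →ₐ[K] K, ∀ t f, ε (σ t f) = ε f := by
  obtain ⟨ε, hε⟩ := exists_invariant_augmentation hreg.abelianizedAction
    (heff.abelianizedAction hreg)
    (fun p hp => by
      obtain ⟨c, -, hc⟩ := MvPolynomial.isUnit_iff_eq_C_of_isReduced.mp hp
      exact ⟨c, hc.symm⟩)
    (by simp [MvPolynomial.trdeg_of_isDomain])
  refine ⟨ε.comp (abelianization K (Fin n)), fun t f => ?_⟩
  rw [AlgHom.comp_apply, AlgHom.comp_apply, ← abelianizedAction_abelianization, hε]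

end FixedPoints

end FreeTorus

theorem mainTheorem1_general {K : Type*} [Field K] [Infinite K] (n : ℕ)
    (σ : FreeTorus.Torus K n →* (FreeAlgebra K (Fin n) ≃ₐ[K] FreeAlgebra K (Fin n)))
    (hreg : FreeTorus.IsRegularAction σ) (heff : FreeTorus.IsEffectiveAction σ) :
    FreeTorus.IsLinearizable σ := by
  obtain ⟨ε, hε⟩ := FreeTorus.exists_invariant_augmentation_freeAlgebra hreg heff
  let α := FreeTorus.translationAut fun i => -ε (FreeAlgebra.ι K i)
  have hα : FreeTorus.FixesOrigin (FreeTorus.conjAction σ α) :=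
    FreeTorus.fixesOrigin_conjAction hε (FreeTorus.comp_translationAut ε)
  exact (hα.isLinearizable (hreg.conj α) (heff.conj α)).of_conj

theorem mainTheorem1 {K : Type*} [Field K] [IsAlgClosed K] (n : ℕ)
    (σ : FreeTorus.Torus K n →* (FreeAlgebra K (Fin n) ≃ₐ[K] FreeAlgebra K (Fin n)))
    (hreg : FreeTorus.IsRegularAction σ) (heff : FreeTorus.IsEffectiveAction σ) :
    FreeTorus.IsLinearizable σ :=
  have : Infinite K := IsAlgClosed.instInfinite
  mainTheorem1_general n σ hreg heff
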